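/- Let $E$ be a Euclidean space (a finite-dimensional real inner product space) of dimension at least $1$, and let $m_1,\dots,m_N>0$ be masses. For a configuration $x=(r_1,\dots,r_N)\in E^N$ put $\|x\|^2=\sum_{i=1}^N m_i\|r_i\|_E^2$ and $$U(x)=\sum_{1\le i<j\le N}\frac{m_im_j}{\|r_i-r_j\|_E}\in[0,+\infty],$$ with $U(x)=+\infty$ if $r_i=r_j$ for some $i\neq j$. For $h\ge 0$ and $x,y\in E^N$ define the action potential $$\phi_h(x,y)=\inf_{\gamma}\int_a^b\Bigl(\tfrac12\|\dot\gamma(t)\|^2+U(\gamma(t))+h\Bigr)\,dt\in[0,+\infty],$$ where the infimum is over all absolutely continuous curves $\gamma:[a,b]\to E^N$, defined on any compact interval with $a<b$, such that $\gamma(a)=x$ and $\gamma(b)=y$. Then there are constants $\alpha,\beta>0$ (depending only on $E$, $N$ and the masses) such that for all configurations $x,y\in E^N$ and every $h\ge 0$, $$\phi_h(x,y)\le\bigl(\alpha\|x-y\|+h\,\beta\,\|x-y\|^2\bigr)^{1/2}.$$ -/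

import Mathlib

open scoped NNReal ENNReal

noncomputable section

namespace NBody

variable {N : ℕ} {E : Type*} [NormedAddCommGroup E] [InnerProductSpace ℝ E]

/-- The norm on the configuration space `E ^ N` of the mass scalar product
`⟪x, y⟫ = ∑ i, m i * ⟪x i, y i⟫`. -/
def massNorm (m : Fin N → ℝ) (x : Fin N → E) : ℝ :=
  √(∑ i, m i * ‖x i‖ ^ 2)

/-- The Newtonian potential `U(x) = ∑_{i < j} m i * m j / ‖x i - x j‖`, with value `∞` exactly at
the configurations with collisions (for positive masses). -/
def potential (m : Fin N → ℝ) (x : Fin N → E) : ℝ≥0∞ :=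
  ∑ i, ∑ j ∈ Finset.Ioi i, ENNReal.ofReal (m i * m j) / ENNReal.ofReal ‖x i - x j‖

/-- The Lagrangian `L(x, v) = ‖v‖ ^ 2 / 2 + U(x)`, with the norm of the mass scalar product. -/
def lagrangian (m : Fin N → ℝ) (x v : Fin N → E) : ℝ≥0∞ :=
  ENNReal.ofReal (massNorm m v ^ 2 / 2) + potential m x

/-- The restriction of `γ` to `[a, b]`, where `a < b`, is an absolutely continuous curve
from `x` to `y`. -/
structure IsCurve (x y : Fin N → E) (a b : ℝ) (γ : ℝ → Fin N → E) : Prop where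
  lt : a < b
  absolutelyContinuous : AbsolutelyContinuousOnInterval γ a b
  left : γ a = x
  right : γ b = y

/-- The action `∫ L(γ, γ') + h dt` over `[a, b]`, which may be infinite. An absolutely continuous
curve is differentiable at almost every `t`, so the value of `deriv` elsewhere is irrelevant. -/
def action (m : Fin N → ℝ) (h : ℝ≥0) (a b : ℝ) (γ : ℝ → Fin N → E) : ℝ≥0∞ :=
  ∫⁻ t in Set.Icc a b, (lagrangian m (γ t) (deriv γ t) + (h : ℝ≥0∞))

/-- The action potential `φ_h(x, y)`: the infimum of the `L + h` action over all absolutely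
continuous curves from `x` to `y`, defined on any compact interval of positive length. -/
def actionPotential (m : Fin N → ℝ) (h : ℝ≥0) (x y : Fin N → E) : ℝ≥0∞ :=
  ⨅ (a : ℝ) (b : ℝ) (γ : ℝ → Fin N → E) (_ : IsCurve x y a b γ), action m h a b γ

end NBody

end

open MeasureTheory Set

/-! Fix a unit vector `e` and let `R` bound the sup-norm distance of `x` and `y`. If two
configurations are weakly ordered alike along `e`, add to the segment joining them a displacement of
each particle along `e` proportional to its rank and to a bump behaving like `s ^ (2/3)` near each
endpoint. Mutual distances are then at least a multiple of the bump. With this exponent of parabolic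
motion, kinetic energy and potential are both of order `s ^ (-2/3)`, hence integrable even if the
endpoints have collisions (`action_spreadSegment_le`).

In general, `exists_monotone_collapse` gives a monotone map sending the coordinates of `x i` and `y
i` along `e` to a common value, with displacement at most `N * R`. This yields an intermediate `z`
weakly ordered both like `x` and like `y`, and the paths from `x` to `z` and from `z` to `y` are
concatenated. The action is at most `C * (R ^ 2 / T + (1 / R + h) * T)`; optimizing `T` gives the
square root. -/

/-! ### Collapsing intervals of the line -/

/-- A monotone map of the line that moves points by a bounded amount and identifies the endpoints
of finitely many given intervals. -/
theorem exists_monotone_collapse {ι : Type*} (s : Finset ι) (u v : ι → ℝ) {R : ℝ}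
    (huv : ∀ i, |u i - v i| ≤ R) :
    ∃ g : ℝ → ℝ, Monotone g ∧ (∀ t t', |g t - g t'| ≤ |t - t'|) ∧
      (∀ t, |g t - t| ≤ s.card * R) ∧ ∀ i ∈ s, g (u i) = g (v i) := by
  classical
  induction s using Finset.induction_on with
  | empty => exact ⟨id, monotone_id, by simp, by simp, by simp⟩
  | insert k s hk ih =>
    obtain ⟨g, hmono, hlip, hdist, heq⟩ := ih
    -- `c` contracts the interval between `g (u k)` and `g (v k)` to its lower end and translates
    -- everything above it down by its length, which is at most `R` because `g` is nonexpansive.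
    obtain ⟨c, hc⟩ : ∃ c : ℝ → ℝ, ∀ t, c t =
      min t (min (g (u k)) (g (v k))) + max t (max (g (u k)) (g (v k)))
        - max (g (u k)) (g (v k)) := ⟨_, fun _ ↦ rfl⟩
    have hR := (hlip (u k) (v k)).trans (huv k)
    have hcm : Monotone c := by
      intro t t' h
      rw [hc, hc]
      have := min_le_min_right (min (g (u k)) (g (v k))) h
      have := max_le_max_right (max (g (u k)) (g (v k))) h
      linarith
    have hcl : ∀ t t', |c t - c t'| ≤ |t - t'| := by
      intro t t'
      rw [hc, hc]
      grind
    have hcd : ∀ t, |c t - t| ≤ R := by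
      intro t
      rw [hc]
      grind
    refine ⟨c ∘ g, hcm.comp hmono, fun t t' ↦ (hcl _ _).trans (hlip _ _), fun t ↦ ?_, ?_⟩
    · rw [Finset.card_insert_of_notMem hk]
      push_cast
      calc |c (g t) - t| ≤ |c (g t) - g t| + |g t - t| := abs_sub_le _ _ _
        _ ≤ _ := by linarith [hcd (g t), hdist t]
    · intro i hi
      rcases Finset.mem_insert.1 hi with rfl | hi
      · simp only [Function.comp_apply, hc]
        grind
      · simp only [Function.comp_apply, heq i hi]

/-! ### Criteria for absolute continuity -/

namespace AbsolutelyContinuousOnInterval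

/-- Precomposition with a nonexpansive map of the line that shrinks intervals. -/
theorem comp_of_uIoc_subset {X : Type*} [PseudoMetricSpace X] {f : ℝ → X} {a b c d : ℝ}
    (hf : AbsolutelyContinuousOnInterval f a b) {p : ℝ → ℝ} (hp : MapsTo p (uIcc c d) (uIcc a b))
    (hd : ∀ t t', dist (p t) (p t') ≤ dist t t') (hs : ∀ t t', uIoc (p t) (p t') ⊆ uIoc t t') :
    AbsolutelyContinuousOnInterval (f ∘ p) c d := by
  rw [absolutelyContinuousOnInterval_iff] at hf ⊢
  intro ε hε
  obtain ⟨δ, hδ, H⟩ := hf ε hε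
  refine ⟨δ, hδ, fun I hI hlt ↦ ?_⟩
  refine H (I.1, fun i ↦ (p (I.2 i).1, p (I.2 i).2)) ⟨fun i hi ↦ ?_, ?_⟩
    ((Finset.sum_le_sum fun i _ ↦ hd _ _).trans_lt hlt)
  · exact ⟨hp (hI.1 i hi).1, hp (hI.1 i hi).2⟩
  · exact fun i hi j hj hij ↦ (hI.2 hi hj hij).mono (hs _ _) (hs _ _)

/-- A continuous function with integrable derivative in the interior is absolutely continuous. -/
theorem of_hasDerivAt {f f' : ℝ → ℝ} {a b : ℝ} (hab : a ≤ b) (hc : ContinuousOn f (Icc a b))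
    (hd : ∀ t ∈ Ioo a b, HasDerivAt f (f' t) t) (hi : IntervalIntegrable f' volume a b) :
    AbsolutelyContinuousOnInterval f a b := by
  have hF := hi.absolutelyContinuousOnInterval_intervalIntegral (c := a) left_mem_uIcc
  have key : ∀ t ∈ uIcc a b, f t = (∫ v in a..t, f' v) + f a := by
    intro t ht
    rw [uIcc_of_le hab] at ht
    rw [intervalIntegral.integral_eq_sub_of_hasDerivAt_of_le ht.1
      (hc.mono (Icc_subset_Icc_right ht.2)) (fun s hs ↦ hd s ⟨hs.1, hs.2.trans_le ht.2⟩)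
      (hi.mono_set (by rw [uIcc_of_le hab, uIcc_of_le ht.1]; exact Icc_subset_Icc_right ht.2))]
    ring
  rw [absolutelyContinuousOnInterval_iff] at hF ⊢
  intro ε hε
  obtain ⟨δ, hδ, H⟩ := hF ε hε
  refine ⟨δ, hδ, fun I hI hlt ↦ (Finset.sum_congr rfl fun i h ↦ ?_).trans_lt (H I hI hlt)⟩
  rw [key _ (hI.1 i h).1, key _ (hI.1 i h).2, dist_add_right]

end AbsolutelyContinuousOnInterval

/-! ### The bump and its weight -/

/-- A bump on `[a, b]` whose squared derivative and whose inverse are integrable. -/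
noncomputable def bump (a b t : ℝ) : ℝ :=
  (t - a) ^ (2 / 3 : ℝ) + (b - t) ^ (2 / 3 : ℝ) - (b - a) ^ (2 / 3 : ℝ)

/-- An integrable weight on `[a, b]` which dominates the squared derivative and the inverse of
`bump a b`. -/
noncomputable def bumpWeight (a b t : ℝ) : ℝ :=
  (t - a) ^ (-(2 / 3) : ℝ) + (b - t) ^ (-(2 / 3) : ℝ)

theorem bump_left (a b : ℝ) : bump a b a = 0 := by
  simp [bump]

theorem bump_right (a b : ℝ) : bump a b b = 0 := by
  simp [bump]

theorem hasDerivAt_bump {a b t : ℝ} (ht : t ∈ Ioo a b) :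
    HasDerivAt (bump a b)
      (2 / 3 * ((t - a) ^ (-(1 / 3) : ℝ) - (b - t) ^ (-(1 / 3) : ℝ))) t := by
  have h1 : HasDerivAt (fun t ↦ (t - a) ^ (2 / 3 : ℝ)) _ t :=
    ((hasDerivAt_id t).sub_const a).rpow_const (Or.inl (sub_pos.2 ht.1).ne')
  have h2 : HasDerivAt (fun t ↦ (b - t) ^ (2 / 3 : ℝ)) _ t :=
    ((hasDerivAt_id t).const_sub b).rpow_const (Or.inl (sub_pos.2 ht.2).ne')
  convert! (h1.add h2).sub_const ((b - a) ^ (2 / 3 : ℝ)) using 1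
  norm_num
  ring

theorem intervalIntegrable_rpow_sub_left {r : ℝ} (hr : -1 < r) (a b : ℝ) :
    IntervalIntegrable (fun t ↦ (t - a) ^ r) volume a b := by
  have := (intervalIntegral.intervalIntegrable_rpow' (a := 0) (b := b - a) hr).comp_sub_right a
  simpa using this

theorem intervalIntegrable_rpow_sub_right {r : ℝ} (hr : -1 < r) (a b : ℝ) :
    IntervalIntegrable (fun t ↦ (b - t) ^ r) volume a b := by
  have := (intervalIntegral.intervalIntegrable_rpow' (a := b - a) (b := 0) hr).comp_sub_left b
  simpa using this

theorem absolutelyContinuousOnInterval_bump {a b : ℝ} (hab : a ≤ b) :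
    AbsolutelyContinuousOnInterval (bump a b) a b := by
  refine .of_hasDerivAt hab ?_ (fun t ht ↦ hasDerivAt_bump ht) ?_
  · refine Continuous.continuousOn (.sub (.add ?_ ?_) continuous_const)
    · exact (continuous_id.sub continuous_const).rpow_const fun _ ↦ Or.inr (by norm_num)
    · exact (continuous_const.sub continuous_id).rpow_const fun _ ↦ Or.inr (by norm_num)
  · exact ((intervalIntegrable_rpow_sub_left (by norm_num) a b).sub
      (intervalIntegrable_rpow_sub_right (by norm_num) a b)).const_mul _

theorem sq_deriv_bump_le {a b t : ℝ} (ht : t ∈ Ioo a b) :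
    (2 / 3 * ((t - a) ^ (-(1 / 3) : ℝ) - (b - t) ^ (-(1 / 3) : ℝ))) ^ 2 ≤ bumpWeight a b t := by
  have h1 := sub_pos.2 ht.1
  have h2 := sub_pos.2 ht.2
  have e : ∀ s : ℝ, 0 < s → s ^ (-(2 / 3) : ℝ) = (s ^ (-(1 / 3) : ℝ)) ^ 2 := by
    intro s hs
    rw [← Real.rpow_natCast, ← Real.rpow_mul hs.le]
    norm_num
  rw [bumpWeight, e _ h1, e _ h2]
  have p := Real.rpow_pos_of_pos h1 (-(1 / 3))
  have q := Real.rpow_pos_of_pos h2 (-(1 / 3))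
  nlinarith [mul_pos p q, sq_nonneg ((t - a) ^ (-(1 / 3) : ℝ)),
    sq_nonneg ((b - t) ^ (-(1 / 3) : ℝ))]

/-- Lets terms constant in time, namely `h` and the squared speed of the segment, be absorbed into
the weight. -/
theorem one_le_bumpWeight {a b t τ : ℝ} (hτ : 0 < τ) (hab : b - a = τ ^ 3) (ht : t ∈ Ioo a b) :
    1 ≤ τ ^ 2 * bumpWeight a b t := by
  have h1 := sub_pos.2 ht.1
  have h2 := sub_pos.2 ht.2
  have h3 : (b - a) ^ (-(2 / 3) : ℝ) ≤ (t - a) ^ (-(2 / 3) : ℝ) :=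
    Real.rpow_le_rpow_of_nonpos h1 (by linarith [ht.2]) (by norm_num)
  have h4 : (b - a) ^ (-(2 / 3) : ℝ) = (τ ^ 2)⁻¹ := by
    rw [hab, ← Real.rpow_natCast, ← Real.rpow_mul hτ.le, ← Real.rpow_natCast,
      ← Real.rpow_neg hτ.le]
    norm_num
  have h5 := Real.rpow_pos_of_pos h2 (-(2 / 3))
  have h6 : 0 < τ ^ 2 := by positivity
  calc 1 = τ ^ 2 * (τ ^ 2)⁻¹ := (mul_inv_cancel₀ h6.ne').symm
    _ ≤ _ := mul_le_mul_of_nonneg_left (by rw [bumpWeight]; linarith) h6.le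

theorem bump_pos_and_inv_le {a b t : ℝ} (ht : t ∈ Ioo a b) :
    0 < bump a b t ∧ (bump a b t)⁻¹ ≤ 5 * bumpWeight a b t := by
  have h1 := sub_pos.2 ht.1
  have h2 := sub_pos.2 ht.2
  have h3 : 0 < b - a := by linarith
  obtain ⟨p, hp, hp'⟩ : ∃ p : ℝ, 0 < p ∧ t - a = p ^ 3 :=
    ⟨(t - a) ^ (1 / 3 : ℝ), by positivity, by
      rw [← Real.rpow_natCast, ← Real.rpow_mul h1.le]; norm_num⟩
  obtain ⟨q, hq, hq'⟩ : ∃ p : ℝ, 0 < p ∧ b - t = p ^ 3 :=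
    ⟨(b - t) ^ (1 / 3 : ℝ), by positivity, by
      rw [← Real.rpow_natCast, ← Real.rpow_mul h2.le]; norm_num⟩
  obtain ⟨c, hc, hc'⟩ : ∃ p : ℝ, 0 < p ∧ b - a = p ^ 3 :=
    ⟨(b - a) ^ (1 / 3 : ℝ), by positivity, by
      rw [← Real.rpow_natCast, ← Real.rpow_mul h3.le]; norm_num⟩
  have e : ∀ s : ℝ, 0 < s → (s ^ 3) ^ (2 / 3 : ℝ) = s ^ 2 := by
    intro s hs
    rw [← Real.rpow_natCast, ← Real.rpow_mul hs.le, ← Real.rpow_natCast]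
    norm_num
  have e' : ∀ s : ℝ, 0 < s → (s ^ 3) ^ (-(2 / 3) : ℝ) = (s ^ 2)⁻¹ := by
    intro s hs
    rw [Real.rpow_neg (by positivity), e s hs]
  rw [bump, bumpWeight, hp', hq', hc', e p hp, e q hq, e c hc, e' p hp, e' q hq]
  have hsum : p ^ 3 + q ^ 3 = c ^ 3 := by linarith
  have key : ∀ p q : ℝ, 0 < p → 0 < q → p ^ 3 + q ^ 3 = c ^ 3 → p ≤ q →
      p ^ 2 / 5 ≤ p ^ 2 + q ^ 2 - c ^ 2 := by
    intro p q hp hq hsum hpq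
    -- `2 * p ^ 3 ≤ c ^ 3`, and `(4 / 5) ^ 3 = 64 / 125` exceeds `1 / 2`.
    have hpc : p ≤ 4 / 5 * c := by
      refine le_of_pow_le_pow_left₀ (n := 3) (by norm_num) (by positivity) ?_
      have := pow_le_pow_left₀ hp.le hpq 3
      nlinarith [pow_pos hc 3]
    have hqc : q ≤ c := by
      refine le_of_pow_le_pow_left₀ (n := 3) (by norm_num) hc.le ?_
      nlinarith [pow_pos hp 3]
    have : c * (p ^ 2 / 5) ≤ c * (p ^ 2 + q ^ 2 - c ^ 2) := by
      have h1 : c * (p ^ 2 + q ^ 2 - c ^ 2) = p ^ 2 * (c - p) + q ^ 2 * (c - q) := by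
        linear_combination hsum
      have h2 : 0 ≤ q ^ 2 * (c - q) := mul_nonneg (sq_nonneg _) (by linarith)
      have h3 : p ^ 2 * (c / 5) ≤ p ^ 2 * (c - p) :=
        mul_le_mul_of_nonneg_left (by linarith) (sq_nonneg _)
      linarith
    exact le_of_mul_le_mul_left this hc
  have fin : ∀ p q B : ℝ, 0 < p → 0 < q → p ^ 2 / 5 ≤ B →
      0 < B ∧ B⁻¹ ≤ 5 * ((p ^ 2)⁻¹ + (q ^ 2)⁻¹) := by
    intro p q B hp hq h
    have h5 : 0 < p ^ 2 / 5 := by positivity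
    refine ⟨h5.trans_le h, (inv_anti₀ h5 h).trans ?_⟩
    have : 0 < (q ^ 2)⁻¹ := by positivity
    rw [inv_div, div_eq_mul_inv]
    linarith
  rcases le_total p q with h | h
  · exact fin p q _ hp hq (key p q hp hq hsum h)
  · have := fin q p _ hq hp (key q p hq hp (by linarith) h)
    rwa [add_comm (q ^ 2), add_comm ((q ^ 2)⁻¹)] at this

theorem bumpWeight_nonneg {a b t : ℝ} (ht : t ∈ Icc a b) : 0 ≤ bumpWeight a b t :=
  add_nonneg (Real.rpow_nonneg (sub_nonneg.2 ht.1) _) (Real.rpow_nonneg (sub_nonneg.2 ht.2) _)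

theorem lintegral_bumpWeight {a b τ : ℝ} (hτ : 0 < τ) (hab : b - a = τ ^ 3) :
    ∫⁻ t in Icc a b, ENNReal.ofReal (bumpWeight a b t) = ENNReal.ofReal (6 * τ) := by
  have hle : a ≤ b := by linarith [pow_pos hτ 3]
  have i1 := intervalIntegrable_rpow_sub_left (r := -(2 / 3)) (by norm_num) a b
  have i2 := intervalIntegrable_rpow_sub_right (r := -(2 / 3)) (by norm_num) a b
  have hint : ∫ t in a..b, bumpWeight a b t = 6 * τ := by
    unfold bumpWeight
    rw [intervalIntegral.integral_add i1 i2,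
      intervalIntegral.integral_comp_sub_right (fun t ↦ t ^ (-(2 / 3) : ℝ)) a,
      intervalIntegral.integral_comp_sub_left (fun t ↦ t ^ (-(2 / 3) : ℝ)) b,
      sub_self, sub_self, integral_rpow (Or.inl (by norm_num)), hab, ← Real.rpow_natCast τ 3,
      ← Real.rpow_mul hτ.le]
    norm_num
    ring
  rw [← ofReal_integral_eq_lintegral_ofReal, integral_Icc_eq_integral_Ioc,
    ← intervalIntegral.integral_of_le hle, hint]
  · exact (intervalIntegrable_iff_integrableOn_Icc_of_le hle).1 (i1.add i2)
  · exact (ae_restrict_iff' measurableSet_Icc).2 (.of_forall fun t ht ↦ bumpWeight_nonneg ht)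

/-! ### Mass norm and potential -/

namespace NBody

variable {N : ℕ} {E : Type*} [NormedAddCommGroup E]

theorem sq_massNorm {m : Fin N → ℝ} (hm : ∀ i, 0 < m i) (x : Fin N → E) :
    massNorm m x ^ 2 = ∑ i, m i * ‖x i‖ ^ 2 :=
  Real.sq_sqrt (Finset.sum_nonneg fun i _ ↦ mul_nonneg (hm i).le (sq_nonneg _))

theorem massNorm_nonneg (m : Fin N → ℝ) (x : Fin N → E) : 0 ≤ massNorm m x :=
  Real.sqrt_nonneg _

theorem sq_massNorm_le {m : Fin N → ℝ} (hm : ∀ i, 0 < m i) {x : Fin N → E} {B : ℝ}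
    (hx : ∀ i, ‖x i‖ ^ 2 ≤ B) : massNorm m x ^ 2 ≤ (∑ i, m i) * B := by
  rw [sq_massNorm hm, Finset.sum_mul]
  exact Finset.sum_le_sum fun i _ ↦ mul_le_mul_of_nonneg_left (hx i) (hm i).le

theorem exists_norm_le_massNorm {m : Fin N → ℝ} (hm : ∀ i, 0 < m i) :
    ∃ μ : ℝ, 0 < μ ∧ ∀ x : Fin N → E, ‖x‖ ≤ μ * massNorm m x := by
  have h0 : ∀ i, 0 < (√(m i))⁻¹ := fun i ↦ inv_pos.2 (Real.sqrt_pos.2 (hm i))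
  have hs : 0 ≤ ∑ i, (√(m i))⁻¹ := Finset.sum_nonneg fun i _ ↦ (h0 i).le
  -- The summand `1` keeps the constant positive when `N = 0`.
  refine ⟨1 + ∑ i, (√(m i))⁻¹, by linarith, fun x ↦ ?_⟩
  refine (pi_norm_le_iff_of_nonneg (mul_nonneg (by linarith) (massNorm_nonneg m x))).2 fun i ↦ ?_
  have h1 : √(m i) * ‖x i‖ ≤ massNorm m x := by
    refine Real.le_sqrt_of_sq_le ?_
    rw [mul_pow, Real.sq_sqrt (hm i).le]
    exact Finset.single_le_sum (f := fun i ↦ m i * ‖x i‖ ^ 2)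
      (fun j _ ↦ mul_nonneg (hm j).le (sq_nonneg _)) (Finset.mem_univ i)
  have h2 : (√(m i))⁻¹ ≤ ∑ i, (√(m i))⁻¹ :=
    Finset.single_le_sum (fun j _ ↦ (h0 j).le) (Finset.mem_univ i)
  calc ‖x i‖ = (√(m i))⁻¹ * (√(m i) * ‖x i‖) := by
        rw [inv_mul_cancel_left₀ (Real.sqrt_pos.2 (hm i)).ne']
    _ ≤ (1 + ∑ i, (√(m i))⁻¹) * massNorm m x :=
        mul_le_mul (by linarith) h1 (by positivity) (by linarith)

/-- A configuration with mutual distances at least `δ` has potential at most `K / δ`. -/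
theorem potential_le {m : Fin N → ℝ} (hm : ∀ i, 0 < m i) {x : Fin N → E} {δ : ℝ} (hδ : 0 < δ)
    (hx : ∀ i j, i ≠ j → δ ≤ ‖x i - x j‖) :
    potential m x ≤ ENNReal.ofReal ((∑ i, ∑ j ∈ Finset.Ioi i, m i * m j) * δ⁻¹) := by
  have hmm : ∀ i j, 0 ≤ m i * m j * δ⁻¹ := fun i j ↦
    mul_nonneg (mul_pos (hm i) (hm j)).le (inv_pos.2 hδ).le
  simp_rw [Finset.sum_mul]
  rw [potential, ENNReal.ofReal_sum_of_nonneg fun i _ ↦ Finset.sum_nonneg fun j _ ↦ hmm i j]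
  refine Finset.sum_le_sum fun i _ ↦ ?_
  rw [ENNReal.ofReal_sum_of_nonneg fun j _ ↦ hmm i j]
  refine Finset.sum_le_sum fun j hj ↦ ?_
  have h := hx i j (Finset.mem_Ioi.1 hj).ne
  rw [← ENNReal.ofReal_div_of_pos (hδ.trans_le h), div_eq_mul_inv]
  exact ENNReal.ofReal_le_ofReal
    (mul_le_mul_of_nonneg_left (inv_anti₀ hδ h) (mul_pos (hm i) (hm j)).le)

variable [InnerProductSpace ℝ E]

/-! ### Action of the spread segment -/

/-- The straight segment from `x` to `y`, spread out in the direction `e` by a multiple of the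
bump function, the particles being ordered by `p`. -/
noncomputable def spreadSegment (e : E) (p : Equiv.Perm (Fin N)) (x y : Fin N → E)
    (a b ρ t : ℝ) : Fin N → E :=
  x + ((t - a) / (b - a)) • (y - x) + (ρ * bump a b t) • fun i ↦ ((p i : ℕ) : ℝ) • e

theorem isCurve_spreadSegment (e : E) (p : Equiv.Perm (Fin N)) (x y : Fin N → E) {a b : ℝ} (ρ : ℝ)
    (hab : a < b) : IsCurve x y a b (spreadSegment e p x y a b ρ) where
  lt := hab
  absolutelyContinuous := by
    refine .add (f := fun t ↦ x + ((t - a) / (b - a)) • (y - x))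
      (g := fun t ↦ (ρ * bump a b t) • fun i ↦ ((p i : ℕ) : ℝ) • e) ?_ ?_
    · refine ContDiffOn.absolutelyContinuousOnInterval (ContDiff.contDiffOn ?_)
      fun_prop
    · refine ((absolutelyContinuousOnInterval_bump hab.le).const_mul ρ).smul
        (g := fun _ ↦ fun i ↦ ((p i : ℕ) : ℝ) • e) ?_
      exact ContDiffOn.absolutelyContinuousOnInterval contDiff_const.contDiffOn
  left := by simp [spreadSegment, bump_left]
  right := by simp [spreadSegment, bump_right, div_self (sub_pos.2 hab).ne']

theorem deriv_spreadSegment (e : E) (p : Equiv.Perm (Fin N)) (x y : Fin N → E) {a b : ℝ} (ρ : ℝ)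
    {t : ℝ} (ht : t ∈ Ioo a b) :
    deriv (spreadSegment e p x y a b ρ) t = (1 / (b - a)) • (y - x) +
      (ρ * (2 / 3 * ((t - a) ^ (-(1 / 3) : ℝ) - (b - t) ^ (-(1 / 3) : ℝ)))) •
        fun i ↦ ((p i : ℕ) : ℝ) • e := by
  refine HasDerivAt.deriv (.add (.const_add _ ?_) ?_)
  · exact (((hasDerivAt_id t).sub_const a).div_const (b - a)).smul_const (y - x)
  · exact ((hasDerivAt_bump ht).const_mul ρ).smul_const _

/-- Along `e`, the segment contributes a convex combination of two nonnegative gaps and the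
spreading adds at least one unit of rank, so nothing cancels. -/
theorem le_norm_spreadSegment_sub {e : E} (he : ‖e‖ = 1) {p : Equiv.Perm (Fin N)} {x y : Fin N → E}
    (hx : ∀ i j, p i < p j → inner ℝ e (x i) ≤ inner ℝ e (x j))
    (hy : ∀ i j, p i < p j → inner ℝ e (y i) ≤ inner ℝ e (y j)) {a b ρ t : ℝ} (hρ : 0 ≤ ρ)
    (ht : t ∈ Ioo a b) {i j : Fin N} (hij : i ≠ j) :
    ρ * bump a b t ≤
      ‖spreadSegment e p x y a b ρ t i - spreadSegment e p x y a b ρ t j‖ := by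
  wlog h : p j < p i generalizing i j
  · rw [norm_sub_rev]
    exact this hij.symm (lt_of_le_of_ne (not_lt.1 h) (p.injective.ne hij))
  have h0 : 0 < b - a := by linarith [ht.1, ht.2]
  have hu : 0 ≤ (t - a) / (b - a) := div_nonneg (sub_pos.2 ht.1).le h0.le
  have hu' : (t - a) / (b - a) ≤ 1 := (div_le_one h0).2 (by linarith [ht.2])
  have hp : (1 : ℝ) ≤ (p i : ℕ) - (p j : ℕ) := by
    have : ((p j : ℕ) : ℝ) + 1 ≤ (p i : ℕ) := by exact_mod_cast Fin.lt_def.1 h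
    linarith
  have hee : inner ℝ e e = (1 : ℝ) := by rw [real_inner_self_eq_norm_sq, he, one_pow]
  have hle := real_inner_le_norm e
    (spreadSegment e p x y a b ρ t i - spreadSegment e p x y a b ρ t j)
  rw [he, one_mul] at hle
  refine le_trans ?_ hle
  simp only [spreadSegment, Pi.add_apply, Pi.smul_apply, Pi.sub_apply, inner_sub_right,
    inner_add_right, inner_smul_right, hee]
  have hb : 0 ≤ ρ * bump a b t := mul_nonneg hρ (bump_pos_and_inv_le ht).1.le
  nlinarith [mul_nonneg hu (sub_nonneg.2 (hy j i h)),
    mul_nonneg (sub_nonneg.2 hu') (sub_nonneg.2 (hx j i h)), mul_nonneg hb (sub_nonneg.2 hp)]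

/-- The bump has size of order `τ ^ 2` on an interval of length `τ ^ 3`, so the amplitude `R / τ ^
2` spreads the particles to distances of order `R`. -/
theorem norm_deriv_spreadSegment_apply_sq_le {e : E} (he : ‖e‖ = 1) (p : Equiv.Perm (Fin N))
    {x y : Fin N → E} {a b t τ R D : ℝ} (hτ : 0 < τ) (hab : b - a = τ ^ 3) (ht : t ∈ Ioo a b)
    (hD : ‖x - y‖ ≤ D) (i : Fin N) :
    ‖deriv (spreadSegment e p x y a b (R / τ ^ 2)) t i‖ ^ 2 ≤
      2 * ((D ^ 2 + N ^ 2 * R ^ 2) / τ ^ 4 * bumpWeight a b t) := by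
  rw [deriv_spreadSegment e p x y _ ht]
  set s := 2 / 3 * ((t - a) ^ (-(1 / 3) : ℝ) - (b - t) ^ (-(1 / 3) : ℝ)) with hs
  have hsw : s ^ 2 ≤ bumpWeight a b t := sq_deriv_bump_le ht
  have hw1 := one_le_bumpWeight hτ hab ht
  have hw : 0 ≤ bumpWeight a b t := bumpWeight_nonneg ⟨ht.1.le, ht.2.le⟩
  have hD0 : 0 ≤ D := (norm_nonneg _).trans hD
  have hv : ‖y i - x i‖ ≤ D := by
    rw [norm_sub_rev]
    exact (norm_le_pi_norm (x - y) i).trans hD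
  have hpN : ((p i : ℕ) : ℝ) ≤ N := by exact_mod_cast (p i).2.le
  simp only [Pi.add_apply, Pi.smul_apply, Pi.sub_apply]
  set A := (1 / (b - a)) • (y i - x i)
  set B := (R / τ ^ 2 * s) • ((p i : ℕ) : ℝ) • e
  have hA : ‖A‖ ^ 2 ≤ D ^ 2 / τ ^ 4 * bumpWeight a b t := by
    calc ‖A‖ ^ 2 = ‖y i - x i‖ ^ 2 / τ ^ 6 := by
          rw [norm_smul, hab, Real.norm_of_nonneg (by positivity)]
          field_simp
      _ ≤ D ^ 2 / τ ^ 6 := by gcongr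
      _ = D ^ 2 / τ ^ 6 * 1 := (mul_one _).symm
      _ ≤ D ^ 2 / τ ^ 6 * (τ ^ 2 * bumpWeight a b t) := by gcongr
      _ = _ := by field_simp
  have hB : ‖B‖ ^ 2 ≤ N ^ 2 * R ^ 2 / τ ^ 4 * bumpWeight a b t := by
    calc ‖B‖ ^ 2 = ((p i : ℕ) : ℝ) ^ 2 * R ^ 2 / τ ^ 4 * s ^ 2 := by
          rw [norm_smul, norm_smul, he, mul_one, mul_pow, Real.norm_eq_abs, Real.norm_eq_abs,
            sq_abs, sq_abs]
          field_simp
      _ ≤ _ := by gcongr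
  calc ‖A + B‖ ^ 2 ≤ (‖A‖ + ‖B‖) ^ 2 := by gcongr; exact norm_add_le _ _
    _ ≤ 2 * (‖A‖ ^ 2 + ‖B‖ ^ 2) := by nlinarith [sq_nonneg (‖A‖ - ‖B‖)]
    _ ≤ 2 * (D ^ 2 / τ ^ 4 * bumpWeight a b t + N ^ 2 * R ^ 2 / τ ^ 4 * bumpWeight a b t) := by
        gcongr
    _ = _ := by ring

/-- Two configurations whose particles are ordered in the same way in the direction `e` are
joined by a curve of controlled action, on any interval of length `τ ^ 3`. -/
theorem action_spreadSegment_le {m : Fin N → ℝ} (hm : ∀ i, 0 < m i) {e : E} (he : ‖e‖ = 1)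
    {p : Equiv.Perm (Fin N)} {x y : Fin N → E}
    (hx : ∀ i j, p i < p j → inner ℝ e (x i) ≤ inner ℝ e (x j))
    (hy : ∀ i j, p i < p j → inner ℝ e (y i) ≤ inner ℝ e (y j)) (h : ℝ≥0)
    {a b τ R D : ℝ} (hτ : 0 < τ) (hab : b - a = τ ^ 3) (hR : 0 < R) (hD : ‖x - y‖ ≤ D) :
    action m h a b (spreadSegment e p x y a b (R / τ ^ 2)) ≤ ENNReal.ofReal
      (6 * τ ^ 3 * ((∑ i, m i) * (D ^ 2 + N ^ 2 * R ^ 2) / τ ^ 6 +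
        5 * (∑ i, ∑ j ∈ Finset.Ioi i, m i * m j) / R + h)) := by
  set M := ∑ i, m i
  set K := ∑ i, ∑ j ∈ Finset.Ioi i, m i * m j
  have hM : 0 ≤ M := Finset.sum_nonneg fun i _ ↦ (hm i).le
  have hK : 0 ≤ K := Finset.sum_nonneg fun i _ ↦ Finset.sum_nonneg fun j _ ↦
    (mul_pos (hm i) (hm j)).le
  set Q := M * (D ^ 2 + N ^ 2 * R ^ 2) / τ ^ 6 + 5 * K / R + h with hQ
  have hQ0 : 0 ≤ Q := by positivity
  have hρ : 0 < R / τ ^ 2 := by positivity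
  have hpt : ∀ t ∈ Ioo a b, lagrangian m (spreadSegment e p x y a b (R / τ ^ 2) t)
      (deriv (spreadSegment e p x y a b (R / τ ^ 2)) t) + (h : ℝ≥0∞) ≤
      ENNReal.ofReal (τ ^ 2 * Q) * ENNReal.ofReal (bumpWeight a b t) := by
    intro t ht
    have hw : 0 ≤ bumpWeight a b t := bumpWeight_nonneg ⟨ht.1.le, ht.2.le⟩
    obtain ⟨hb, hb'⟩ := bump_pos_and_inv_le ht
    have h1 := sq_massNorm_le hm fun i ↦
      norm_deriv_spreadSegment_apply_sq_le (R := R) he p hτ hab ht hD i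
    have h2 := potential_le hm (mul_pos hρ hb) fun i j hij ↦
      le_norm_spreadSegment_sub he hx hy hρ.le ht hij
    have h3 : (h : ℝ) ≤ h * (τ ^ 2 * bumpWeight a b t) :=
      le_mul_of_one_le_right h.coe_nonneg (one_le_bumpWeight hτ hab ht)
    have h4 : K * (R / τ ^ 2 * bump a b t)⁻¹ ≤ K * ((R / τ ^ 2)⁻¹ * (5 * bumpWeight a b t)) := by
      rw [mul_inv]
      gcongr
    rw [lagrangian, ← ENNReal.ofReal_mul (by positivity), ← ENNReal.ofReal_coe_nnreal]
    refine (add_le_add_left (add_le_add_right h2 _) _).trans ?_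
    have h6 : 0 ≤ K * (R / τ ^ 2 * bump a b t)⁻¹ :=
      mul_nonneg hK (inv_pos.2 (mul_pos hρ hb)).le
    rw [← ENNReal.ofReal_add (by positivity) h6,
      ← ENNReal.ofReal_add (add_nonneg (by positivity) h6) h.coe_nonneg]
    refine ENNReal.ofReal_le_ofReal ?_
    have h5 : τ ^ 2 * Q * bumpWeight a b t =
        M * ((D ^ 2 + N ^ 2 * R ^ 2) / τ ^ 4 * bumpWeight a b t) +
        K * ((R / τ ^ 2)⁻¹ * (5 * bumpWeight a b t)) + h * (τ ^ 2 * bumpWeight a b t) := by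
      rw [hQ]
      field_simp
    rw [h5]
    linarith
  calc action m h a b (spreadSegment e p x y a b (R / τ ^ 2))
      = ∫⁻ t in Ioo a b, _ := setLIntegral_congr Ioo_ae_eq_Icc.symm
    _ ≤ ∫⁻ t in Ioo a b, ENNReal.ofReal (τ ^ 2 * Q) * ENNReal.ofReal (bumpWeight a b t) :=
        setLIntegral_mono' measurableSet_Ioo hpt
    _ ≤ ∫⁻ t in Icc a b, ENNReal.ofReal (τ ^ 2 * Q) * ENNReal.ofReal (bumpWeight a b t) :=
        lintegral_mono_set Ioo_subset_Icc_self
    _ = ENNReal.ofReal (τ ^ 2 * Q) * ENNReal.ofReal (6 * τ) := by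
        rw [lintegral_const_mul' _ _ ENNReal.ofReal_ne_top, lintegral_bumpWeight hτ hab]
    _ = _ := by
        rw [← ENNReal.ofReal_mul (by positivity)]
        congr 1
        ring

/-! ### Concatenation and the action bound -/

/-- Concatenation of curves. -/
theorem IsCurve.exists_trans {x y z : Fin N → E} {a b c : ℝ} {γ₁ γ₂ : ℝ → Fin N → E}
    (h₁ : IsCurve x z a b γ₁) (h₂ : IsCurve z y b c γ₂) (m : Fin N → ℝ) (h : ℝ≥0) :
    ∃ γ, IsCurve x y a c γ ∧ action m h a c γ ≤ action m h a b γ₁ + action m h b c γ₂ := by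
  have hab := h₁.lt
  have hbc := h₂.lt
  -- Gluing as a sum of curves stopped at time `b` reduces absolute continuity to sums and
  -- compositions with clamping maps.
  obtain ⟨γ, hγ⟩ : ∃ γ : ℝ → Fin N → E, γ = fun t ↦ γ₁ (min t b) + γ₂ (max t b) - z := ⟨_, rfl⟩
  have e₁ : ∀ t ≤ b, γ t = γ₁ t := fun t ht ↦ by
    simp [hγ, min_eq_left ht, max_eq_right ht, h₂.left]
  have e₂ : ∀ t, b ≤ t → γ t = γ₂ t := fun t ht ↦ by
    simp [hγ, min_eq_right ht, max_eq_left ht, h₁.right]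
  refine ⟨γ, ⟨hab.trans hbc, ?_, by rw [e₁ a hab.le, h₁.left], by rw [e₂ c hbc.le, h₂.right]⟩, ?_⟩
  · rw [hγ]
    refine .sub (f := (γ₁ ∘ fun t ↦ min t b) + (γ₂ ∘ fun t ↦ max t b)) (g := fun _ ↦ z)
      (.add (h₁.absolutelyContinuous.comp_of_uIoc_subset ?_ ?_ ?_)
        (h₂.absolutelyContinuous.comp_of_uIoc_subset ?_ ?_ ?_))
      (ContDiffOn.absolutelyContinuousOnInterval contDiff_const.contDiffOn)
    · intro t ht
      rw [uIcc_of_le (hab.trans hbc).le] at ht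
      rw [uIcc_of_le hab.le]
      exact ⟨le_min ht.1 hab.le, min_le_right _ _⟩
    · intro t t'
      rw [Real.dist_eq, Real.dist_eq]
      grind
    · intro t t' s
      simp only [uIoc, mem_Ioc]
      grind
    · intro t ht
      rw [uIcc_of_le (hab.trans hbc).le] at ht
      rw [uIcc_of_le hbc.le]
      exact ⟨le_max_right _ _, max_le ht.2 hbc.le⟩
    · intro t t'
      rw [Real.dist_eq, Real.dist_eq]
      grind
    · intro t t' s
      simp only [uIoc, mem_Ioc]
      grind
  · have aux : ∀ {a b : ℝ} {γ γ' : ℝ → Fin N → E}, (∀ t ∈ Ioo a b, γ t = γ' t) →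
        action m h a b γ = action m h a b γ' := by
      intro a b γ γ' hγ
      unfold action
      rw [setLIntegral_congr Ioo_ae_eq_Icc.symm, setLIntegral_congr Ioo_ae_eq_Icc.symm]
      refine setLIntegral_congr_fun measurableSet_Ioo fun t ht ↦ ?_
      have : γ =ᶠ[nhds t] γ' := Filter.eventually_of_mem (isOpen_Ioo.mem_nhds ht) hγ
      simp only [hγ t ht, this.deriv_eq]
    rw [← aux (fun t ht ↦ e₁ t ht.2.le), ← aux (fun t ht ↦ e₂ t ht.1.le), action,
      ← Icc_union_Icc_eq_Icc hab.le hbc.le]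
    exact lintegral_union_le _ _ _

theorem actionPotential_le {m : Fin N → ℝ} {h : ℝ≥0} {x y : Fin N → E} {a b : ℝ}
    {γ : ℝ → Fin N → E} (hγ : IsCurve x y a b γ) : actionPotential m h x y ≤ action m h a b γ :=
  iInf_le_of_le a <| iInf_le_of_le b <| iInf_le_of_le γ <| iInf_le _ hγ

/-- The bound obtained from curves of duration `2 * T` which stay at distance of order `R`
from the endpoints. -/
theorem exists_actionPotential_le [Nontrivial E] {m : Fin N → ℝ} (hm : ∀ i, 0 < m i) :
    ∃ C : ℝ, 0 < C ∧ ∀ (x y : Fin N → E) (h : ℝ≥0) (R T : ℝ), 0 < R → 0 < T → ‖x - y‖ ≤ R →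
      actionPotential m h x y ≤ ENNReal.ofReal (C * (R ^ 2 / T + (1 / R + h) * T)) := by
  obtain ⟨e, he⟩ := exists_norm_eq E zero_le_one
  obtain ⟨M, hM⟩ : ∃ M : ℝ, M = ∑ i, m i := ⟨_, rfl⟩
  obtain ⟨K, hK⟩ : ∃ K : ℝ, K = ∑ i, ∑ j ∈ Finset.Ioi i, m i * m j := ⟨_, rfl⟩
  have hM0 : 0 ≤ M := hM ▸ Finset.sum_nonneg fun i _ ↦ (hm i).le
  have hK0 : 0 ≤ K := hK ▸ Finset.sum_nonneg fun i _ ↦ Finset.sum_nonneg fun j _ ↦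
    (mul_pos (hm i) (hm j)).le
  refine ⟨12 * (M * ((N + 1) ^ 2 + N ^ 2) + 5 * K + 1), by positivity, ?_⟩
  intro x y h R T hR hT hxy
  obtain ⟨τ, hτ, rfl⟩ : ∃ τ : ℝ, 0 < τ ∧ τ ^ 3 = T :=
    ⟨T ^ (1 / 3 : ℝ), by positivity, by
      rw [← Real.rpow_natCast, ← Real.rpow_mul hT.le]; norm_num⟩
  obtain ⟨g, hg, -, hgd, hgxy⟩ := exists_monotone_collapse Finset.univ
    (fun i ↦ inner ℝ e (x i)) (fun i ↦ inner ℝ e (y i)) (R := R) fun i ↦ by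
      rw [← inner_sub_right]
      refine (abs_real_inner_le_norm _ _).trans ?_
      rw [he, one_mul]
      exact (norm_le_pi_norm (x - y) i).trans hxy
  rw [Finset.card_univ, Fintype.card_fin] at hgd
  -- Only the coordinate along `e` of `x` changes; `z` may have collisions.
  obtain ⟨z, hz⟩ : ∃ z : Fin N → E,
      z = fun i ↦ x i + (g (inner ℝ e (x i)) - inner ℝ e (x i)) • e := ⟨_, rfl⟩
  have hzx : ∀ i, inner ℝ e (z i) = g (inner ℝ e (x i)) := fun i ↦ by
    rw [hz, inner_add_right, inner_smul_right, real_inner_self_eq_norm_sq, he]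
    ring
  have hzy : ∀ i, inner ℝ e (z i) = g (inner ℝ e (y i)) := fun i ↦
    (hzx i).trans (hgxy i (Finset.mem_univ i))
  have hxz : ‖x - z‖ ≤ N * R := by
    refine (pi_norm_le_iff_of_nonneg (by positivity)).2 fun i ↦ ?_
    simp only [hz, Pi.sub_apply, sub_add_cancel_left, norm_neg, norm_smul, he, mul_one]
    exact hgd _
  have hzy' : ‖z - y‖ ≤ (N + 1) * R := by
    have := norm_sub_le_norm_sub_add_norm_sub z x y
    rw [norm_sub_rev z x] at this
    linarith
  have hxz' : ‖x - z‖ ≤ (N + 1) * R := hxz.trans (by linarith)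
  have hsort : ∀ w : Fin N → E, ∃ p : Equiv.Perm (Fin N),
      ∀ i j, p i < p j → inner ℝ e (w i) ≤ inner ℝ e (w j) := by
    intro w
    -- `Tuple.sort` sends ranks to particles; its inverse gives the rank of a particle.
    refine ⟨(Tuple.sort fun i ↦ inner ℝ e (w i))⁻¹, fun i j hij ↦ ?_⟩
    simpa using Tuple.monotone_sort (fun i ↦ inner ℝ e (w i)) hij.le
  obtain ⟨p, hp⟩ := hsort x
  obtain ⟨q, hq⟩ := hsort y
  have hτ3 : 0 < τ ^ 3 := by positivity
  obtain ⟨γ, hγ, hγ'⟩ := (isCurve_spreadSegment e p x z (R / τ ^ 2) hτ3).exists_trans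
    (isCurve_spreadSegment e q z y (R / τ ^ 2) (show τ ^ 3 < τ ^ 3 + τ ^ 3 by linarith)) m h
  refine (actionPotential_le hγ).trans (hγ'.trans ?_)
  refine (add_le_add
    (action_spreadSegment_le hm he hp (fun i j hij ↦ ?_) h hτ (by ring) hR hxz')
    (action_spreadSegment_le hm he (fun i j hij ↦ ?_) hq h hτ (by ring) hR hzy')).trans ?_
  · rw [hzx, hzx]
    exact hg (hp i j hij)
  · rw [hzy, hzy]
    exact hg (hq i j hij)
  rw [← hM, ← hK, ← ENNReal.ofReal_add (by positivity) (by positivity)]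
  refine ENNReal.ofReal_le_ofReal ?_
  set A := M * (((N : ℝ) + 1) ^ 2 + N ^ 2) with hA
  have hA0 : 0 ≤ A := by positivity
  have e1 : M * (((N + 1) * R) ^ 2 + N ^ 2 * R ^ 2) / τ ^ 6 = A * (R ^ 2 / τ ^ 6) := by
    rw [hA]
    ring
  have e2 : R ^ 2 / τ ^ 3 + (1 / R + h) * τ ^ 3 = τ ^ 3 * (R ^ 2 / τ ^ 6 + 1 / R + h) := by
    field_simp
    ring
  rw [e1, e2]
  have h1 : 0 ≤ R ^ 2 / τ ^ 6 := by positivity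
  have h2 : 0 ≤ 1 / R := by positivity
  have h3 : 0 ≤ (h : ℝ) := h.coe_nonneg
  have h4 : A * (R ^ 2 / τ ^ 6) + 5 * K / R + h ≤
      (A + 5 * K + 1) * (R ^ 2 / τ ^ 6 + 1 / R + h) := by
    have : 5 * K / R = 5 * K * (1 / R) := by ring
    rw [this]
    have h6 : 0 ≤ 5 * K := by positivity
    nlinarith [mul_nonneg hA0 h2, mul_nonneg hA0 h3, mul_nonneg h6 h1, mul_nonneg h6 h3]
  calc _ = 12 * τ ^ 3 * (A * (R ^ 2 / τ ^ 6) + 5 * K / R + h) := by ring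
    _ ≤ 12 * τ ^ 3 * ((A + 5 * K + 1) * (R ^ 2 / τ ^ 6 + 1 / R + h)) := by gcongr
    _ = _ := by ring

/-- The bound of `exists_actionPotential_le` for the optimal duration. -/
theorem exists_actionPotential_le_sqrt [Nontrivial E] {m : Fin N → ℝ} (hm : ∀ i, 0 < m i) :
    ∃ C : ℝ, 0 < C ∧ ∀ (x y : Fin N → E) (h : ℝ≥0) (R : ℝ), 0 < R → ‖x - y‖ ≤ R →
      actionPotential m h x y ≤ ENNReal.ofReal √(C * (R + h * R ^ 2)) := by
  obtain ⟨C, hC, H⟩ := exists_actionPotential_le (E := E) hm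
  refine ⟨4 * C ^ 2, by positivity, fun x y h R hR hxy ↦ ?_⟩
  set s := √(1 / R + h) with hs
  have h0 : 0 < 1 / R + (h : ℝ) := add_pos_of_pos_of_nonneg (by positivity) h.coe_nonneg
  have hs0 : 0 < s := Real.sqrt_pos.2 h0
  have hs2 : 1 / R + (h : ℝ) = s ^ 2 := (Real.sq_sqrt h0.le).symm
  -- `T = R / s` equates `R ^ 2 / T` and `s ^ 2 * T`, for a total of `2 * C * R * s`.
  refine (H x y h R (R / s) hR (by positivity) hxy).trans (ENNReal.ofReal_le_ofReal ?_)
  refine Real.le_sqrt_of_sq_le (le_of_eq ?_)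
  have h1 : R + h * R ^ 2 = R ^ 2 * s ^ 2 := by
    rw [← hs2]
    field_simp
  rw [h1, hs2]
  field_simp
  ring

end NBody

theorem theorem2p1 {N : ℕ} {E : Type*} [NormedAddCommGroup E] [InnerProductSpace ℝ E]
    [FiniteDimensional ℝ E] [Nontrivial E] (m : Fin N → ℝ) (hm : ∀ i, 0 < m i) :
    ∃ α β : ℝ, 0 < α ∧ 0 < β ∧ ∀ (x y : Fin N → E) (h : ℝ≥0),
      NBody.actionPotential m h x y ≤
        ENNReal.ofReal
          ((α * NBody.massNorm m (x - y) + h * β * NBody.massNorm m (x - y) ^ 2) ^ (1 / 2 : ℝ)) := by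
  obtain ⟨C, hC, H⟩ := NBody.exists_actionPotential_le_sqrt (E := E) hm
  obtain ⟨μ, hμ, hnorm⟩ := NBody.exists_norm_le_massNorm (E := E) hm
  refine ⟨C * μ, C * μ ^ 2, by positivity, by positivity, fun x y h ↦ ?_⟩
  set d := NBody.massNorm m (x - y)
  have hd : 0 ≤ d := NBody.massNorm_nonneg m _
  -- The bound needs `R > 0`, so `R` decreases to `μ * d`; this covers `x = y` as well.
  have lim : Filter.Tendsto (fun R : ℝ ↦ ENNReal.ofReal √(C * (R + h * R ^ 2)))
      (nhdsWithin (μ * d) (Ioi (μ * d))) (nhds (ENNReal.ofReal √(C * (μ * d + h * (μ * d) ^ 2)))) :=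
    ((ENNReal.continuous_ofReal.comp (by fun_prop)).tendsto _).mono_left nhdsWithin_le_nhds
  have key := ge_of_tendsto lim (Filter.eventually_of_mem self_mem_nhdsWithin fun R hR ↦
    H x y h R ((mul_nonneg hμ.le hd).trans_lt hR) ((hnorm _).trans (le_of_lt hR)))
  rw [← Real.sqrt_eq_rpow]
  convert! key using 3
  ring
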